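/- Let $n\ge 1$, let $c\ne 0$ be a real constant, and let $u\in L^\infty(\mathbb R^n)$ be a real-valued function, not almost everywhere zero, satisfying $-\Delta u=c^2u$ on $\mathbb R^n$ in the weak (distributional) sense, i.e. $$\int_{\mathbb R^n} u\,(-\Delta\varphi)\,dx=\int_{\mathbb R^n}c^2u\,\varphi\,dx\qquad\text{for all }\varphi\in C_c^\infty(\mathbb R^n).$$ Then $u$ changes sign near infinity: for every $R$, both sets $\{x:|x|>R,\ u(x)>0\}$ and $\{x:|x|>R,\ u(x)<0\}$ have positive Lebesgue measure. (Equivalently, a bounded weak solution that is almost everywhere $\ge 0$, or almost everywhere $\le 0$, outside some ball vanishes almost everywhere on $\mathbb R^n$.) -/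

import Mathlib

open MeasureTheory
open scoped ENNReal ContDiff Laplacian

/-- `u` is a real-valued weak (distributional) solution of `-Δ u = V u` on `ℝⁿ`. -/
def IsWeakSolution {n : ℕ} (V u : EuclideanSpace ℝ (Fin n) → ℝ) : Prop :=
  LocallyIntegrable u volume ∧ LocallyIntegrable (fun x => V x * u x) volume ∧
    ∀ φ : EuclideanSpace ℝ (Fin n) → ℝ, ContDiff ℝ ∞ φ → HasCompactSupport φ →
      ∫ x, u x * (-(Δ φ) x) = ∫ x, V x * u x * φ x

/-- `u` is a (nontrivial) eigenfunction of `-Δ` on `ℝⁿ` with eigenvalue `a`,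
in the weak sense. As usual for elements of `L¹_loc`, nontrivial means not a.e. zero. -/
def IsEigenfunction {n : ℕ} (a : ℝ) (u : EuclideanSpace ℝ (Fin n) → ℝ) : Prop :=
  IsWeakSolution (fun _ => a) u ∧ ¬ (u =ᵐ[volume] 0)

/-- `u` changes sign near infinity: outside every ball it is neither a.e. nonnegative
nor a.e. nonpositive. -/
def ChangesSignNearInfinity {n : ℕ} (u : EuclideanSpace ℝ (Fin n) → ℝ) : Prop :=
  ∀ R : ℝ, 0 < volume {x | R < ‖x‖ ∧ 0 < u x} ∧ 0 < volume {x | R < ‖x‖ ∧ u x < 0}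

/-!
Let `u` be a weak solution of `-Δ u = a u` with `a > 0` that is nonnegative near infinity. On a
ball of large radius a bump function `φ` satisfies `Δ φ + a φ > 0`: the standard bump satisfies
`Δ φ ≥ -C φ` on the unit ball, and `C` scales like the inverse square of the radius. Testing
`u ≥ 0` against such a `φ` forces `u = 0` on every such ball far from the origin, so `u` vanishes
outside a compact set and is integrable. Then `(a - |2πξ|²) û(ξ) = 0` for all `ξ`, so `û` vanishes
off a sphere, which is a null set, and `u = 0`.
-/

open Filter Module Topology
open scoped Convolution FourierTransform Real

section Laplacian

variable {E F : Type*} [NormedAddCommGroup E] [InnerProductSpace ℝ E] [FiniteDimensional ℝ E]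
  [NormedAddCommGroup F] [NormedSpace ℝ F]

lemma continuous_laplacian {f : E → F} (hf : ContDiff ℝ 2 f) : Continuous (Δ f) := by
  have := hf.continuous_iteratedFDeriv (m := 2) le_rfl
  rw [InnerProductSpace.laplacian_eq_iteratedFDeriv_stdOrthonormalBasis]
  fun_prop

lemma hasCompactSupport_laplacian {f : E → F} (hf : HasCompactSupport f) :
    HasCompactSupport (Δ f) := by
  refine (hf.iteratedFDeriv (𝕜 := ℝ) 2).mono fun x hx h => hx ?_
  simp [InnerProductSpace.laplacian_eq_iteratedFDeriv_stdOrthonormalBasis, h]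

lemma laplacian_comp_add_smul {f : E → F} (hf : ContDiff ℝ 2 f) (c : E) (a : ℝ) (x : E) :
    (Δ fun y => f (c + a • y)) x = a ^ 2 • (Δ f) (c + a • x) := by
  have hfc : ContDiff ℝ 2 fun z => f (c + z) := by fun_prop
  simp only [InnerProductSpace.laplacian_eq_iteratedFDeriv_stdOrthonormalBasis, Finset.smul_sum,
    iteratedFDeriv_comp_const_smul a hfc, iteratedFDeriv_comp_add_left]
  rfl

lemma laplacian_comp_norm_sq {g g' g'' : ℝ → ℝ} (hg : ∀ t, HasDerivAt g (g' t) t)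
    (hg' : ∀ t, HasDerivAt g' (g'' t) t) (x : E) :
    (Δ fun y : E => g (‖y‖ ^ 2)) x
      = 4 * ‖x‖ ^ 2 * g'' (‖x‖ ^ 2) + 2 * finrank ℝ E * g' (‖x‖ ^ 2) := by
  have hnorm (y : E) : HasFDerivAt (fun z : E => ‖z‖ ^ 2) (2 • innerSL ℝ y) y :=
    (hasStrictFDerivAt_norm_sq y).hasFDerivAt
  have hfderiv : fderiv ℝ (fun y : E => g (‖y‖ ^ 2))
      = fun y => g' (‖y‖ ^ 2) • (2 : ℕ) • innerSL ℝ y :=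
    funext fun y => ((hg _).comp_hasFDerivAt y (hnorm y)).fderiv
  have hfderiv₂ : HasFDerivAt (fun y : E => g' (‖y‖ ^ 2) • (2 : ℕ) • innerSL ℝ y) _ x :=
    ((hg' _).comp_hasFDerivAt x (hnorm x)).smul ((innerSL ℝ).hasFDerivAt.const_smul (2 : ℕ))
  set b := stdOrthonormalBasis ℝ E
  have hterm (i) : iteratedFDeriv ℝ 2 (fun y : E => g (‖y‖ ^ 2)) x ![b i, b i]
      = 4 * g'' (‖x‖ ^ 2) * inner ℝ x (b i) ^ 2 + 2 * g' (‖x‖ ^ 2) := by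
    rw [iteratedFDeriv_two_apply, hfderiv, hfderiv₂.fderiv]
    simp only [Function.comp_apply, Matrix.cons_val_zero, Matrix.cons_val_one,
      Matrix.cons_val_fin_one, add_apply, smul_apply, ContinuousLinearMap.smulRight_apply,
      innerSL_apply_apply ℝ, nsmul_eq_mul, Nat.cast_ofNat, smul_eq_mul, real_inner_self_eq_norm_sq,
      b.norm_eq_one, one_pow, mul_one]
    ring
  rw [InnerProductSpace.laplacian_eq_iteratedFDeriv_orthonormalBasis _ b]
  simp only [hterm, Finset.sum_add_distrib, ← Finset.mul_sum, b.sum_sq_inner_left,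
    Finset.sum_const, Finset.card_univ, Fintype.card_fin, nsmul_eq_mul]
  ring

end Laplacian

section StdBump

variable {E : Type*} [NormedAddCommGroup E]

/-- The standard bump function `exp (-1 / (1 - ‖x‖ ^ 2))`, extended by zero outside the unit
ball. -/
noncomputable def stdBump (x : E) : ℝ := expNegInvGlue (1 - ‖x‖ ^ 2)

lemma stdBump_nonneg (x : E) : 0 ≤ stdBump x := expNegInvGlue.nonneg _

lemma stdBump_eq_zero_iff {x : E} : stdBump x = 0 ↔ 1 ≤ ‖x‖ := by
  rw [stdBump, expNegInvGlue.zero_iff_nonpos, sub_nonpos, one_le_sq_iff₀ (norm_nonneg x)]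

variable [InnerProductSpace ℝ E]

lemma contDiff_stdBump : ContDiff ℝ ∞ (stdBump : E → ℝ) :=
  expNegInvGlue.contDiff.comp (contDiff_const.sub (contDiff_norm_sq ℝ))

variable [FiniteDimensional ℝ E]

lemma hasCompactSupport_stdBump : HasCompactSupport (stdBump : E → ℝ) :=
  .of_support_subset_isCompact (isCompact_closedBall 0 1) fun x hx => by
    rw [mem_closedBall_zero_iff]
    exact (lt_of_not_ge (mt stdBump_eq_zero_iff.2 hx)).le

lemma laplacian_stdBump (x : E) :
    (Δ (stdBump : E → ℝ)) x
      = (4 * ‖x‖ ^ 2 * ((1 - ‖x‖ ^ 2)⁻¹ ^ 4 - 2 * (1 - ‖x‖ ^ 2)⁻¹ ^ 3)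
          - 2 * finrank ℝ E * (1 - ‖x‖ ^ 2)⁻¹ ^ 2) * stdBump x := by
  have hg (t : ℝ) : HasDerivAt (fun t => expNegInvGlue (1 - t))
      (-((1 - t)⁻¹ ^ 2 * expNegInvGlue (1 - t))) t := by
    simpa using (expNegInvGlue.hasDerivAt_polynomial_eval_inv_mul 1 (1 - t)).comp_const_sub 1 t
  have hg' (t : ℝ) : HasDerivAt (fun t => -((1 - t)⁻¹ ^ 2 * expNegInvGlue (1 - t)))
      (((1 - t)⁻¹ ^ 4 - 2 * (1 - t)⁻¹ ^ 3) * expNegInvGlue (1 - t)) t := by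
    have := ((expNegInvGlue.hasDerivAt_polynomial_eval_inv_mul (.X ^ 2)
      (1 - t)).comp_const_sub 1 t).fun_neg
    simp only [Polynomial.eval_pow, Polynomial.eval_X] at this
    refine this.congr_deriv ?_
    simp only [Polynomial.derivative_X_pow, Polynomial.eval_mul, Polynomial.eval_pow,
      Polynomial.eval_X, Polynomial.eval_sub, Polynomial.eval_C, neg_neg]
    push_cast
    ring
  unfold stdBump
  rw [laplacian_comp_norm_sq hg hg']
  ring

-- With `p = (1 - ‖x‖ ^ 2)⁻¹`, the coefficient of `stdBump x` in `laplacian_stdBump` is a quartic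
-- polynomial in `p` with positive leading term; completing squares bounds it from below.
lemma neg_mul_stdBump_le_laplacian_stdBump (x : E) :
    -((finrank ℝ E + 5) ^ 2 / 2) * stdBump x ≤ (Δ (stdBump : E → ℝ)) x := by
  rcases le_or_gt 1 ‖x‖ with hx | hx
  · simp [laplacian_stdBump, stdBump_eq_zero_iff.2 hx]
  rw [laplacian_stdBump]
  refine mul_le_mul_of_nonneg_right ?_ (stdBump_nonneg x)
  have hs : 1 - ‖x‖ ^ 2 ≠ 0 := by nlinarith [norm_nonneg x]
  set p := (1 - ‖x‖ ^ 2)⁻¹ with hp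
  have hxp : ‖x‖ ^ 2 * p = p - 1 := by rw [hp]; field_simp; ring
  calc -(((finrank ℝ E : ℝ) + 5) ^ 2 / 2)
      ≤ 2 * (p ^ 2 - 3 * p) ^ 2 + 2 * (p ^ 2 - (finrank ℝ E + 5) / 2) ^ 2
          - (finrank ℝ E + 5) ^ 2 / 2 := by
        linarith [sq_nonneg (p ^ 2 - 3 * p), sq_nonneg (p ^ 2 - ((finrank ℝ E : ℝ) + 5) / 2)]
    _ = 4 * (p - 1) * (p ^ 3 - 2 * p ^ 2) - 2 * finrank ℝ E * p ^ 2 := by ring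
    _ = 4 * ‖x‖ ^ 2 * (p ^ 4 - 2 * p ^ 3) - 2 * finrank ℝ E * p ^ 2 := by rw [← hxp]; ring

lemma exists_bump_neg_mul_le_laplacian (z : E) {r : ℝ} (hr : 0 < r) :
    ∃ φ : E → ℝ, ContDiff ℝ ∞ φ ∧ HasCompactSupport φ ∧
      (∀ x ∈ Metric.ball z r,
        0 < φ x ∧ -((finrank ℝ E + 5) ^ 2 / (2 * r ^ 2)) * φ x ≤ (Δ φ) x) ∧
      ∀ x ∉ Metric.ball z r, φ x = 0 ∧ (Δ φ) x = 0 := by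
  let T (x : E) : E := -(r⁻¹ • z) + r⁻¹ • x
  have hT (x : E) : ‖T x‖ = ‖x - z‖ / r := by
    rw [show T x = r⁻¹ • (x - z) by simp only [T]; module, norm_smul, norm_inv,
      Real.norm_of_nonneg hr.le, inv_mul_eq_div]
  have hzero (x : E) : stdBump (T x) = 0 ↔ x ∉ Metric.ball z r := by
    rw [stdBump_eq_zero_iff, hT, one_le_div₀ hr, mem_ball_iff_norm, not_lt]
  have hΔ (x : E) : (Δ fun x => stdBump (T x)) x = r⁻¹ ^ 2 * (Δ (stdBump : E → ℝ)) (T x) :=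
    laplacian_comp_add_smul (contDiff_infty.1 contDiff_stdBump 2) _ _ x
  have hle (x : E) : -((finrank ℝ E + 5) ^ 2 / (2 * r ^ 2)) * stdBump (T x)
      ≤ (Δ fun x => stdBump (T x)) x :=
    calc -((finrank ℝ E + 5) ^ 2 / (2 * r ^ 2)) * stdBump (T x)
        = r⁻¹ ^ 2 * (-((finrank ℝ E + 5) ^ 2 / 2) * stdBump (T x)) := by field_simp
      _ ≤ r⁻¹ ^ 2 * (Δ (stdBump : E → ℝ)) (T x) :=
        mul_le_mul_of_nonneg_left (neg_mul_stdBump_le_laplacian_stdBump _) (by positivity)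
      _ = (Δ fun x => stdBump (T x)) x := (hΔ x).symm
  refine ⟨fun x => stdBump (T x), contDiff_stdBump.comp (by fun_prop), ?_,
    fun x hx => ⟨?_, ?_⟩, fun x hx => ⟨(hzero x).2 hx, ?_⟩⟩
  · refine .of_support_subset_isCompact (isCompact_closedBall z r) fun x hx => ?_
    exact Metric.ball_subset_closedBall (not_not.1 (mt (hzero x).2 hx))
  · exact (stdBump_nonneg _).lt_of_ne' (mt (hzero x).1 (not_not.2 hx))
  · exact hle x
  · rw [hΔ, laplacian_stdBump, (hzero x).2 hx, mul_zero, mul_zero]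

end StdBump

section Fourier

variable {E : Type*} [NormedAddCommGroup E] [InnerProductSpace ℝ E] [FiniteDimensional ℝ E]
  [MeasurableSpace E] [BorelSpace E]

lemma integral_fourier_mul_eq {f g : E → ℂ} (hf : Integrable f) (hg : Integrable g) :
    ∫ ξ, 𝓕 f ξ * g ξ = ∫ x, f x * 𝓕 g x := by
  simpa using! VectorFourier.integral_fourierIntegral_smul_eq_flip (L := innerₗ E)
    Real.continuous_fourierChar continuous_inner hf hg

lemma ae_eq_zero_of_fourier_ae_eq_zero {f : E → ℂ} (hf : Integrable f)
    (h : ∀ᵐ ξ, 𝓕 f ξ = 0) : f =ᵐ[volume] 0 := by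
  refine ae_eq_zero_of_integral_contDiff_smul_eq_zero hf.locallyIntegrable fun g hg hgc => ?_
  have hgc' : HasCompactSupport (Complex.ofRealCLM ∘ g) := hgc.comp_left rfl
  let ψ : SchwartzMap E ℂ := hgc'.toSchwartzMap (by fun_prop)
  calc ∫ x, g x • f x = ∫ x, f x * 𝓕 ⇑(𝓕⁻ ψ : SchwartzMap E ℂ) x := by
        simp [← SchwartzMap.fourier_coe, FourierTransform.fourier_fourierInv_eq, ψ, mul_comm]
    _ = ∫ ξ, 𝓕 f ξ * (𝓕⁻ ψ) ξ := (integral_fourier_mul_eq hf (𝓕⁻ ψ).integrable).symm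
    _ = 0 := integral_eq_zero_of_ae (h.mono fun ξ hξ => by simp [hξ])

lemma exists_contDiff_fourier_ne_zero (ξ : E) :
    ∃ φ : E → ℝ, ContDiff ℝ ∞ φ ∧ HasCompactSupport φ ∧ 𝓕 (fun x => (φ x : ℂ)) ξ ≠ 0 := by
  by_contra! h
  have hcont : Continuous fun x : E => (Real.fourierChar (-inner ℝ x ξ) : ℂ) := by fun_prop
  have hchar : ∀ᵐ x : E, (Real.fourierChar (-inner ℝ x ξ) : ℂ) = 0 :=
    ae_eq_zero_of_integral_contDiff_smul_eq_zero hcont.locallyIntegrable fun φ hφ hc => by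
      simpa [Real.fourier_eq, Circle.smul_def, mul_comm] using h φ hφ hc
  obtain ⟨x, hx⟩ := hchar.exists
  exact Circle.coe_ne_zero _ hx

lemma fourier_laplacian_apply {F : Type*} [NormedAddCommGroup F] [NormedSpace ℂ F]
    [CompleteSpace F] (f : SchwartzMap E F) (ξ : E) :
    𝓕 (Δ f) ξ = -(2 * π * ‖ξ‖) ^ 2 • 𝓕 f ξ := by
  rw [SchwartzMap.laplacian_eq_fourierMultiplierCLM, FourierTransform.fourier_smul,
    SchwartzMap.fourierMultiplierCLM_apply, FourierTransform.fourier_fourierInv_eq, smul_apply,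
    SchwartzMap.smulLeftCLM_apply_apply (by fun_prop), smul_smul]
  ring_nf

lemma fourier_laplacian_add {φ : E → ℝ} (hφ : ContDiff ℝ ∞ φ) (hc : HasCompactSupport φ)
    (a : ℝ) (ξ : E) :
    𝓕 (fun x => (((Δ φ) x + a * φ x : ℝ) : ℂ)) ξ
      = (a - (2 * π * ‖ξ‖) ^ 2 : ℝ) * 𝓕 (fun x => (φ x : ℂ)) ξ := by
  have hc' : HasCompactSupport (Complex.ofRealCLM ∘ φ) := hc.comp_left rfl
  let ψ : SchwartzMap E ℂ := hc'.toSchwartzMap (by fun_prop)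
  have hψ (x) : (Δ ψ) x = (Δ φ) x := by
    rw [SchwartzMap.laplacian_apply]
    exact (contDiff_infty.1 hφ 2).contDiffAt.laplacian_CLM_comp_left (l := Complex.ofRealCLM)
  have hsum : (fun x => (((Δ φ) x + a * φ x : ℝ) : ℂ)) = ⇑(Δ ψ + (a : ℂ) • ψ) := by
    ext x
    rw [add_apply, smul_apply, hψ, Complex.ofReal_add, Complex.ofReal_mul]
    rfl
  have hφψ : 𝓕 (fun x => (φ x : ℂ)) ξ = 𝓕 ψ ξ := rfl
  rw [hsum, ← SchwartzMap.fourier_coe, FourierTransform.fourier_add,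
    FourierTransform.fourier_smul, add_apply, smul_apply, fourier_laplacian_apply, hφψ,
    Complex.real_smul, smul_eq_mul, ← add_mul]
  push_cast
  ring

end Fourier

section WeakSolution

variable {n : ℕ} {a R : ℝ} {V u φ : EuclideanSpace ℝ (Fin n) → ℝ}

namespace IsWeakSolution

lemma neg (hu : IsWeakSolution V u) : IsWeakSolution V (-u) := by
  refine ⟨hu.1.neg, ?_, fun φ hφ hc => ?_⟩
  · simpa only [Pi.neg_apply, mul_neg] using! hu.2.1.neg
  · simpa only [Pi.neg_apply, mul_neg, neg_mul, integral_neg, neg_inj] using hu.2.2 φ hφ hc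

lemma integrable_mul_laplacian (hu : IsWeakSolution V u) (hφ : ContDiff ℝ ∞ φ)
    (hc : HasCompactSupport φ) : Integrable fun x => u x * (Δ φ) x := by
  simpa only [smul_eq_mul, mul_comm] using
    hu.1.integrable_smul_left_of_hasCompactSupport
      (continuous_laplacian (contDiff_infty.1 hφ 2)) (hasCompactSupport_laplacian hc)

lemma integrable_mul_mul (hu : IsWeakSolution V u) (hφ : Continuous φ)
    (hc : HasCompactSupport φ) : Integrable fun x => u x * (V x * φ x) := by
  simpa only [smul_eq_mul, mul_comm, mul_left_comm] using
    hu.2.1.integrable_smul_left_of_hasCompactSupport hφ hc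

lemma integral_mul_laplacian_add (hu : IsWeakSolution V u) (hφ : ContDiff ℝ ∞ φ)
    (hc : HasCompactSupport φ) : ∫ x, u x * ((Δ φ) x + V x * φ x) = 0 := by
  have hweak : -∫ x, u x * (Δ φ) x = ∫ x, u x * (V x * φ x) := by
    simpa only [mul_neg, integral_neg, mul_assoc, mul_left_comm] using hu.2.2 φ hφ hc
  simp only [mul_add]
  rw [integral_add (hu.integrable_mul_laplacian hφ hc) (hu.integrable_mul_mul hφ.continuous hc),
    ← hweak, add_neg_cancel]

lemma ae_eq_zero_of_nonneg_on_ball (hu : IsWeakSolution V u) {z : EuclideanSpace ℝ (Fin n)}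
    {r : ℝ} (hr : 0 < r) (hV : ∀ x ∈ Metric.ball z r, (n + 5) ^ 2 / (2 * r ^ 2) < V x)
    (hpos : ∀ᵐ x, x ∈ Metric.ball z r → 0 ≤ u x) :
    ∀ᵐ x, x ∈ Metric.ball z r → u x = 0 := by
  obtain ⟨φ, hφ, hc, hin, hout⟩ := exists_bump_neg_mul_le_laplacian z hr
  rw [finrank_euclideanSpace_fin] at hin
  have hint : Integrable fun x => u x * ((Δ φ) x + V x * φ x) := by
    simpa only [mul_add] using!
      (hu.integrable_mul_laplacian hφ hc).add (hu.integrable_mul_mul hφ.continuous hc)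
  have hW_pos : ∀ x ∈ Metric.ball z r, 0 < (Δ φ) x + V x * φ x := fun x hx => by
    linarith [hin x hx, mul_lt_mul_of_pos_right (hV x hx) (hin x hx).1]
  have hnonneg : 0 ≤ᵐ[volume] fun x => u x * ((Δ φ) x + V x * φ x) := by
    filter_upwards [hpos] with x hx
    by_cases hxB : x ∈ Metric.ball z r
    · exact mul_nonneg (hx hxB) (hW_pos x hxB).le
    · simp [hout x hxB]
  filter_upwards [(integral_eq_zero_iff_of_nonneg_ae hnonneg hint).1
    (hu.integral_mul_laplacian_add hφ hc)] with x hx hxB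
  exact (mul_eq_zero.1 hx).resolve_right (hW_pos x hxB).ne'

lemma exists_ae_eq_zero_outside_ball (ha : 0 < a) (hu : IsWeakSolution V u)
    (hV : ∀ x, R < ‖x‖ → a ≤ V x) (hR : ∀ᵐ x, R < ‖x‖ → 0 ≤ u x) :
    ∃ R', ∀ᵐ x, R' < ‖x‖ → u x = 0 := by
  obtain ⟨r, hr, hra⟩ : ∃ r : ℝ, 0 < r ∧ (n + 5) ^ 2 / (2 * r ^ 2) < a := by
    have h : Tendsto (fun r : ℝ => (n + 5 : ℝ) ^ 2 / (2 * r ^ 2)) atTop (𝓝 0) :=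
      ((tendsto_pow_atTop two_ne_zero).const_mul_atTop two_pos).const_div_atTop _
    exact ((eventually_gt_atTop 0).and (h.eventually_lt_const ha)).exists
  have hball {z x : EuclideanSpace ℝ (Fin n)} (hz : R + r < ‖z‖) (hx : x ∈ Metric.ball z r) :
      R < ‖x‖ := by
    linarith [norm_sub_norm_le z x, mem_ball_iff_norm'.1 hx]
  have hloc (z : EuclideanSpace ℝ (Fin n)) (hz : R + r < ‖z‖) :
      ∀ᵐ x, x ∈ Metric.ball z r → u x = 0 :=
    hu.ae_eq_zero_of_nonneg_on_ball hr (fun x hx => hra.trans_le (hV x (hball hz hx)))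
      (hR.mono fun x hx hxB => hx (hball hz hxB))
  refine ⟨R + r, ?_⟩
  rw [ae_iff]
  refine measure_null_of_locally_null _ fun z hz => ?_
  obtain ⟨hzR, -⟩ := Classical.not_imp.1 hz
  refine ⟨_, inter_mem_nhdsWithin _ (Metric.ball_mem_nhds z hr), ?_⟩
  refine measure_mono_null ?_ (ae_iff.1 (hloc z hzR))
  exact fun x hx h => hx.1 fun _ => h hx.2

lemma integrable_of_nonneg_near_infinity (ha : 0 < a) (hu : IsWeakSolution V u)
    (hV : ∀ x, R < ‖x‖ → a ≤ V x) (hR : ∀ᵐ x, R < ‖x‖ → 0 ≤ u x) : Integrable u := by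
  obtain ⟨R', hR'⟩ := hu.exists_ae_eq_zero_outside_ball ha hV hR
  refine (hu.1.integrableOn_isCompact (isCompact_closedBall 0 R')).integrable_of_ae_notMem_eq_zero
    (hR'.mono fun x hx hxB => hx ?_)
  rwa [mem_closedBall_zero_iff, not_le] at hxB

lemma convolution_laplacian_add_eq_zero (hu : IsWeakSolution (fun _ => a) u)
    (hφ : ContDiff ℝ ∞ φ) (hc : HasCompactSupport φ) :
    u ⋆ (fun x => (Δ φ) x + a * φ x) = 0 := by
  ext x
  have hΔ (t) : (Δ fun t => φ (x + (-1 : ℝ) • t)) t = (Δ φ) (x + (-1 : ℝ) • t) := by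
    rw [laplacian_comp_add_smul (contDiff_infty.1 hφ 2), neg_one_sq, one_smul]
  have hc' : HasCompactSupport fun t => φ (x + (-1 : ℝ) • t) := by
    simpa [sub_eq_add_neg, Function.comp_def] using hc.comp_homeomorph (Homeomorph.subLeft x)
  have hφ' : ContDiff ℝ ∞ fun t => φ (x + (-1 : ℝ) • t) := by fun_prop
  have hzero := hu.integral_mul_laplacian_add hφ' hc'
  simp only [hΔ] at hzero
  simpa [convolution_def, sub_eq_add_neg] using hzero

lemma fourier_eq_zero (hu : IsWeakSolution (fun _ => a) u) (hint : Integrable u)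
    {ξ : EuclideanSpace ℝ (Fin n)} (hξ : (2 * π * ‖ξ‖) ^ 2 ≠ a) :
    𝓕 (fun x => (u x : ℂ)) ξ = 0 := by
  obtain ⟨φ, hφ, hc, hne⟩ := exists_contDiff_fourier_ne_zero ξ
  have hw : Integrable fun x => (Δ φ) x + a * φ x :=
    ((continuous_laplacian (contDiff_infty.1 hφ 2)).integrable_of_hasCompactSupport
      (hasCompactSupport_laplacian hc)).add
      ((hφ.continuous.integrable_of_hasCompactSupport hc).const_mul a)
  have hconv : (fun x => (u x : ℂ)) ⋆[ContinuousLinearMap.mul ℂ ℂ]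
      (fun x => (((Δ φ) x + a * φ x : ℝ) : ℂ)) = 0 := by
    ext x
    simp only [convolution_def, ContinuousLinearMap.mul_apply', ← Complex.ofReal_mul]
    rw [integral_complex_ofReal]
    exact congr_arg Complex.ofReal (congr_fun (hu.convolution_laplacian_add_eq_zero hφ hc) x)
  have hmul : 𝓕 (fun x => (u x : ℂ)) ξ
      * ((a - (2 * π * ‖ξ‖) ^ 2 : ℝ) * 𝓕 (fun x => (φ x : ℂ)) ξ) = 0 := by
    rw [← fourier_laplacian_add hφ hc]
    calc 𝓕 (fun x => (u x : ℂ)) ξ * 𝓕 (fun x => (((Δ φ) x + a * φ x : ℝ) : ℂ)) ξ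
        = 𝓕 ((fun x => (u x : ℂ)) ⋆[ContinuousLinearMap.mul ℂ ℂ]
            (fun x => (((Δ φ) x + a * φ x : ℝ) : ℂ))) ξ :=
          (Real.fourier_mul_convolution_eq hint.ofReal hw.ofReal ξ).symm
      _ = 0 := by rw [hconv, Real.fourier_eq]; simp
  refine (mul_eq_zero.1 hmul).resolve_right (mul_ne_zero ?_ hne)
  exact_mod_cast sub_ne_zero.2 hξ.symm

lemma ae_eq_zero_of_integrable (ha : 0 < a) (hu : IsWeakSolution (fun _ => a) u)
    (hint : Integrable u) : u =ᵐ[volume] 0 := by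
  have hsphere : ∀ᵐ ξ : EuclideanSpace ℝ (Fin n), ξ ∉ Metric.sphere 0 (√a / (2 * π)) :=
    measure_eq_zero_iff_ae_notMem.1 (Measure.addHaar_sphere_of_ne_zero volume 0 (by positivity))
  have hfourier : ∀ᵐ ξ, 𝓕 (fun x => (u x : ℂ)) ξ = 0 := by
    filter_upwards [hsphere] with ξ hξ
    refine hu.fourier_eq_zero hint fun h => hξ ?_
    rw [mem_sphere_zero_iff_norm, ← h, Real.sqrt_sq (by positivity)]
    field_simp
  filter_upwards [ae_eq_zero_of_fourier_ae_eq_zero hint.ofReal hfourier] with x hx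
  simpa using hx

end IsWeakSolution

lemma IsEigenfunction.neg (hu : IsEigenfunction a u) : IsEigenfunction a (-u) :=
  ⟨hu.1.neg, fun h => hu.2 (h.mono fun x hx => by simpa using hx)⟩

lemma IsEigenfunction.volume_neg_pos (ha : 0 < a) (hu : IsEigenfunction a u) (R : ℝ) :
    0 < volume {x | R < ‖x‖ ∧ u x < 0} := by
  refine pos_iff_ne_zero.2 fun h => hu.2 ?_
  have hnonneg : ∀ᵐ x, R < ‖x‖ → 0 ≤ u x :=
    (measure_eq_zero_iff_ae_notMem.1 h).mono fun x hx hxR => not_lt.1 fun hlt => hx ⟨hxR, hlt⟩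
  exact hu.1.ae_eq_zero_of_integrable ha
    (hu.1.integrable_of_nonneg_near_infinity ha (fun _ _ => le_rfl) hnonneg)

end WeakSolution

theorem theorem1p6_general {n : ℕ} {a : ℝ} (ha : 0 < a) {u : EuclideanSpace ℝ (Fin n) → ℝ}
    (hu : IsEigenfunction a u) : ChangesSignNearInfinity u := fun R =>
  ⟨by simpa using hu.neg.volume_neg_pos ha R, hu.volume_neg_pos ha R⟩

theorem theorem1p6 (n : ℕ) (hn : 1 ≤ n) (c : ℝ) (hc : c ≠ 0)
    (u : EuclideanSpace ℝ (Fin n) → ℝ) (hbdd : MemLp u ∞ volume)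
    (hu : IsEigenfunction (c ^ 2) u) :
    ChangesSignNearInfinity u :=
  theorem1p6_general (by positivity) hu
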